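/- Let $R$ be an associative ring with identity (not necessarily commutative) and let $Q=(V,E)$ be any quiver, with set of vertices $V$ and set of arrows $E$ (no finiteness is assumed). Let $(Q,R\text{-Mod})$ be the abelian category of representations of $Q$ by left $R$-modules, i.e. of functors from the path category of $Q$ to $R\text{-Mod}$. A representation $M$ is called componentwise flat if $M(v)$ is a flat left $R$-module for every $v\in V$; let $\mathscr F_{cw}$ be the class of componentwise flat representations. The cardinality of $M$ is $|M|=\bigl|\coprod_{v\in V}M(v)\bigr|$ (disjoint union of the underlying sets). For a class $\mathscr F$ of representations let $\mathscr F^{\perp}$ be the class of representations $C$ with $\operatorname{Ext}^1(F,C)=0$ for all $F\in\mathscr F$; the pair $(\mathscr F,\mathscr F^\perp)$ is said to be cogenerated by a set if there is a set $T\subseteq\mathscr F$ with $T^\perp=\mathscr F^\perp$. Theorem. The pair $(\mathscr F_{cw},\mathscr F_{cw}^{\perp})$ is cogenerated by a set. More precisely, let $\aleph$ be any infinite cardinal with $\aleph\ge\sup\{|R|,|V|,|E|\}$. Then there is a set of representatives of the isomorphism classes of componentwise flat representations of cardinality at most $\aleph$, and every such set of representatives $T$ satisfies $T^{\perp}=\mathscr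 F_{cw}^{\perp}$. -/

import Mathlib

open CategoryTheory Cardinal
open scoped TensorProduct

universe u v

/-! ### Tensor products and flatness over a noncommutative ring

Right `R`-modules are modules over the opposite ring `Rᵐᵒᵖ`, with `l * r` written
`MulOpposite.op r • l`. -/

/-- The relations `l r ⊗ m - l ⊗ r m` inside `L ⊗_ℤ M`. -/
def balancedRelations (R L M : Type*) [Ring R] [AddCommGroup L] [Module Rᵐᵒᵖ L]
    [AddCommGroup M] [Module R M] : Submodule ℤ (L ⊗[ℤ] M) :=
  Submodule.span ℤ
    {t | ∃ (l : L) (r : R) (m : M), t = (MulOpposite.op r • l) ⊗ₜ[ℤ] m - l ⊗ₜ[ℤ] (r • m)}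

/-- The abelian group `L ⊗_R M`, for a right `R`-module `L` and a left `R`-module `M`. -/
abbrev RingTensor (R L M : Type*) [Ring R] [AddCommGroup L] [Module Rᵐᵒᵖ L]
    [AddCommGroup M] [Module R M] : Type _ :=
  (L ⊗[ℤ] M) ⧸ balancedRelations R L M

theorem balancedRelations_le_comap (R : Type*) {L L' : Type*} (M : Type*) [Ring R]
    [AddCommGroup L] [Module Rᵐᵒᵖ L] [AddCommGroup L'] [Module Rᵐᵒᵖ L']
    [AddCommGroup M] [Module R M] (f : L →ₗ[Rᵐᵒᵖ] L') :
    balancedRelations R L M ≤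
      (balancedRelations R L' M).comap
        (LinearMap.rTensor M f.toAddMonoidHom.toIntLinearMap) := by
  refine Submodule.span_le.2 ?_
  rintro _ ⟨l, r, m, rfl⟩
  refine Submodule.subset_span ⟨f l, r, m, ?_⟩
  simp

/-- The map `f ⊗_R M : L ⊗_R M → L' ⊗_R M` induced by a map `f : L → L'` of right
`R`-modules. -/
def RingTensor.map {R L L' : Type*} (M : Type*) [Ring R]
    [AddCommGroup L] [Module Rᵐᵒᵖ L] [AddCommGroup L'] [Module Rᵐᵒᵖ L']
    [AddCommGroup M] [Module R M] (f : L →ₗ[Rᵐᵒᵖ] L') :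
    RingTensor R L M →ₗ[ℤ] RingTensor R L' M :=
  Submodule.mapQ _ _ (LinearMap.rTensor M f.toAddMonoidHom.toIntLinearMap)
    (balancedRelations_le_comap R M f)

/-- A left module `M` over a (not necessarily commutative) ring `R` is flat if the functor
`- ⊗_R M` on right `R`-modules preserves injectivity (it is always right exact). -/
def IsFlatModule (R : Type u) (M : Type u) [Ring R] [AddCommGroup M] [Module R M] : Prop :=
  ∀ (L L' : Type u) [AddCommGroup L] [Module Rᵐᵒᵖ L] [AddCommGroup L'] [Module Rᵐᵒᵖ L']
    (f : L →ₗ[Rᵐᵒᵖ] L'), Function.Injective f → Function.Injective (RingTensor.map M f)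

/-! ### `Ext`-orthogonal classes in an abelian category -/

section Abelian

variable {C : Type u} [Category.{v} C] [Abelian C]

/-- The class `F^⊥` of all objects `X` such that `Ext¹(Y, X) = 0` for all `Y` in `F`. -/
def extPerp (F : ObjectProperty C) : ObjectProperty C := fun X =>
  haveI : HasExt.{max u v} C := HasExt.standard C
  ∀ Y : C, F Y → Subsingleton (Abelian.Ext.{max u v} Y X 1)

/-- The pair `(F, F^⊥)` is cogenerated by a set: there is a set (a small class) `T` of objects
of `F` with `T^⊥ = F^⊥`. -/
def IsCogeneratedBySet (F : ObjectProperty C) : Prop :=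
  ∃ T : ObjectProperty C, ObjectProperty.Small.{v} T ∧ T ≤ F ∧ extPerp T = extPerp F

/-- `T` is a set of representatives (up to isomorphism) of the objects in the class `P`. -/
structure IsSetOfRepresentatives (T P : ObjectProperty C) : Prop where
  small : ObjectProperty.Small.{v} T
  le : T ≤ P
  existsUnique : ∀ X : C, P X → ∃! Y : C, T Y ∧ Nonempty (X ≅ Y)

end Abelian

/-! ### Representations of a quiver -/

section Quiver

variable (R : Type u) [Ring R] (V : Type u) [Quiver.{u} V]

/-- The category `(Q, R-Mod)` of representations by left `R`-modules of the quiver `Q` with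
vertex type `V`: functors from the path category of `Q` to `R`-modules. -/
abbrev QuiverRep : Type (u + 1) := Paths V ⥤ ModuleCat.{u} R

variable {R V}

/-- The cardinality of a representation: that of the disjoint union of its modules. -/
def repCard (M : QuiverRep R V) : Cardinal.{u} := #(Σ v : Paths V, M.obj v)

variable (R V)

/-- The class `F_cw` of componentwise flat representations. -/
def componentwiseFlat : ObjectProperty (QuiverRep R V) := fun M =>
  ∀ v : Paths V, IsFlatModule R (M.obj v)

/-- The class of componentwise flat representations of cardinality at most `κ`. -/
def componentwiseFlatLE (κ : Cardinal.{u}) : ObjectProperty (QuiverRep R V) := fun M =>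
  componentwiseFlat R V M ∧ repCard M ≤ κ

end Quiver

/-! Embed `X` in an injective `I` with cokernel `Q`. The long exact sequence turns `Ext¹(Y, X) = 0`
into: every map `Y ⟶ Q` lifts to `I`. So it suffices that if all componentwise flat representations
of size at most `κ` have this lifting property, then so does every componentwise flat `F`.

The key is `exists_small_pure_subrep`: in a componentwise flat `M`, each element lies in a
subrepresentation `S` of size at most `κ` with both `S` and `M/S` componentwise flat. As in the
downward Löwenheim-Skolem theorem, one closes the element under chosen solutions of finite linear
systems; there are at most `κ` of these, since paths are finite lists of arrows.

Zorn's lemma then replaces a transfinite filtration of `F`. Consider partial lifts on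
subrepresentations `D` of `F` with `F/D` componentwise flat. They pass to unions of chains. If `D`
misses an element, the key lemma applied to `F/D` gives a larger `D'` with `D'/D` small and flat,
and the lift extends over `D'` (`exists_extension`).

All of this uses flatness in equational form, `Submodule.FlatQuotient`; its equivalence with the
tensor definition over a noncommutative ring is proved by hand. -/

/-- Every linear relation `∑ rᵢ mᵢ ∈ N` is, modulo `N`, a consequence of relations between
scalars; for `N = ⊥` this is the equational criterion for flatness of `M`. -/
def Submodule.FlatQuotient {R M : Type*} [Ring R] [AddCommGroup M] [Module R M]
    (N : Submodule R M) : Prop :=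
  ∀ (n : ℕ) (r : Fin n → R) (m : Fin n → M), ∑ i, r i • m i ∈ N →
    ∃ (p : ℕ) (a : Fin n → Fin p → R) (m' : Fin p → M),
      (∀ i, m i - ∑ j, a i j • m' j ∈ N) ∧ ∀ j, ∑ i, r i * a i j = 0

/-! ### Vanishing of tensors over a noncommutative ring -/

namespace RingTensor

variable {R L M : Type*} [Ring R] [AddCommGroup L] [Module Rᵐᵒᵖ L]
    [AddCommGroup M] [Module R M]

/-- The pure tensor `l ⊗ m` in `L ⊗_R M`. -/
def tmul (l : L) (m : M) : RingTensor R L M := Submodule.Quotient.mk (l ⊗ₜ[ℤ] m)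

theorem tmul_add (l : L) (m m' : M) :
    (tmul l (m + m') : RingTensor R L M) = tmul l m + tmul l m' := by
  simp [tmul, TensorProduct.tmul_add]

theorem add_tmul (l l' : L) (m : M) :
    (tmul (l + l') m : RingTensor R L M) = tmul l m + tmul l' m := by
  simp [tmul, TensorProduct.add_tmul]

theorem op_smul_tmul (l : L) (r : R) (m : M) :
    (tmul (MulOpposite.op r • l) m : RingTensor R L M) = tmul l (r • m) :=
  (Submodule.Quotient.eq _).2 (Submodule.subset_span ⟨l, r, m, rfl⟩)

/-- The pure tensor map as a biadditive map. -/
def tmulHom : L →+ M →+ RingTensor R L M :=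
  AddMonoidHom.mk' (fun l => AddMonoidHom.mk' (fun m => tmul l m) (tmul_add l))
    (fun l l' => by ext m; exact add_tmul l l' m)

theorem map_tmul {L' : Type*} [AddCommGroup L'] [Module Rᵐᵒᵖ L'] (f : L →ₗ[Rᵐᵒᵖ] L')
    (l : L) (m : M) : RingTensor.map M f (tmul l m) = tmul (f l) m := by
  rfl

/-- A balanced biadditive map descends to the tensor product over `R`. -/
theorem exists_lift {A : Type*} [AddCommGroup A] (b : L →+ M →+ A)
    (hb : ∀ l (r : R) m, b (MulOpposite.op r • l) m = b l (r • m)) :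
    ∃ φ : RingTensor R L M →+ A, ∀ l m, φ (tmul l m) = b l m := by
  let b' : L →ₗ[ℤ] M →ₗ[ℤ] A :=
    LinearMap.mk₂ ℤ (fun l m => b l m) (by simp) (by simp) (by simp) (by simp)
  refine ⟨((balancedRelations R L M).liftQ (TensorProduct.lift b') ?_).toAddMonoidHom, ?_⟩
  · refine Submodule.span_le.2 ?_
    rintro _ ⟨l, r, m, rfl⟩
    exact ((TensorProduct.lift b').map_sub _ _).trans (sub_eq_zero.2 (hb l r m))
  · intro l m
    rfl

theorem exists_finsupp (t : RingTensor R L M) :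
    ∃ g : L →₀ M, t = g.sum fun l m => tmul l m := by
  obtain ⟨t, rfl⟩ := Submodule.Quotient.mk_surjective _ t
  have key : ∀ g h : L →₀ M, ((g + h).sum fun l m => (tmul l m : RingTensor R L M)) =
      (g.sum fun l m => tmul l m) + h.sum fun l m => tmul l m := fun g h =>
    Finsupp.sum_add_index' (fun l => (tmulHom l).map_zero) (fun l => (tmulHom l).map_add)
  induction t with
  | zero => exact ⟨0, by simp⟩
  | tmul l m =>
    refine ⟨Finsupp.single l m, ?_⟩
    rw [Finsupp.sum_single_index]
    · rfl
    · exact (tmulHom l).map_zero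
  | add x y hx hy =>
    obtain ⟨g, hg⟩ := hx
    obtain ⟨h, hh⟩ := hy
    exact ⟨g + h, by rw [key, ← hg, ← hh]; rfl⟩

/-- The family `(aₗ m)ₗ` of elements of `M`. -/
noncomputable def column {ι : Type*} (a : ι →₀ R) (m : M) : ι →₀ M :=
  a.mapRange (fun r => r • m) (zero_smul _ _)

@[simp] theorem column_apply {ι : Type*} (a : ι →₀ R) (m : M) (i : ι) :
    column a m i = a i • m := rfl

@[simp] theorem column_add {ι : Type*} (a b : ι →₀ R) (m : M) :
    column (a + b) m = column a m + column b m := by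
  ext i; simp [add_smul]

@[simp] theorem column_sub {ι : Type*} (a b : ι →₀ R) (m : M) :
    column (a - b) m = column a m - column b m := by
  ext i; simp [sub_smul]

@[simp] theorem column_neg {ι : Type*} (a : ι →₀ R) (m : M) :
    column (-a) m = - column a m := by
  ext i; simp

@[simp] theorem column_single {ι : Type*} (i : ι) (r : R) (m : M) :
    column (Finsupp.single i r) m = Finsupp.single i (r • m) := by
  classical
  ext j; simp [Finsupp.single_apply, ite_smul]

theorem sum_column (a : L →₀ R) (m : M) :
    ((column a m).sum fun l x => (tmul l x : RingTensor R L M)) =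
      tmul (a.sum fun l r => MulOpposite.op r • l) m := by
  rw [column, Finsupp.sum_mapRange_index (h := fun l x => (tmul l x : RingTensor R L M))
    (fun l => (tmulHom l).map_zero)]
  have : ∀ l : L, (tmul l m : RingTensor R L M) = tmulHom.flip m l := fun l => rfl
  rw [this, map_finsuppSum]
  exact Finsupp.sum_congr fun l _ => (op_smul_tmul l (a l) m).symm

/-- A vanishing element `∑ l ⊗ gₗ` of `L ⊗_R M` is a sum of trivially vanishing ones. -/
theorem exists_columns_of_sum_tmul_eq_zero (g : L →₀ M)
    (h : (g.sum fun l m => (tmul l m : RingTensor R L M)) = 0) :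
    ∃ (n : ℕ) (a : Fin n → L →₀ R) (m : Fin n → M),
      (∀ j, ((a j).sum fun l r => MulOpposite.op r • l) = 0) ∧ g = ∑ j, column (a j) (m j) := by
  let N : AddSubgroup (L →₀ M) := AddSubgroup.closure
    {g | ∃ (a : L →₀ R) (m : M), (a.sum fun l r => MulOpposite.op r • l) = 0 ∧ g = column a m}
  have hadd : ∀ a b : L →₀ R, ((a + b).sum fun l r => MulOpposite.op r • l) =
      (a.sum fun l r => MulOpposite.op r • l) + b.sum fun l r => MulOpposite.op r • l :=
    fun a b => Finsupp.sum_add_index' (by simp) (by simp [add_smul])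
  have hneg : ∀ a : L →₀ R, ((-a).sum fun l r => MulOpposite.op r • l) =
      - (a.sum fun l r => MulOpposite.op r • l) := fun a => by
    rw [Finsupp.sum_neg_index (by simp)]; simp [Finsupp.sum]
  have hsub : ∀ a b : L →₀ R, ((a - b).sum fun l r => MulOpposite.op r • l) =
      (a.sum fun l r => MulOpposite.op r • l) - b.sum fun l r => MulOpposite.op r • l :=
    fun a b => by rw [sub_eq_add_neg, hadd, hneg, sub_eq_add_neg]
  have hs : ∀ (l : L) (r : R),
      ((Finsupp.single l r).sum fun l r => MulOpposite.op r • l) = MulOpposite.op r • l :=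
    fun l r => Finsupp.sum_single_index (by simp)
  -- The assignment `l ⊗ m ↦ [single l m]` is well defined because the defects of additivity and
  -- balance are themselves columns of vanishing combinations. It sends `∑ l ⊗ g l` to the class of
  -- `g`, so `g ∈ N`.
  let b : L →+ M →+ (L →₀ M) ⧸ N := AddMonoidHom.mk'
    (fun l => (QuotientAddGroup.mk' N).comp (Finsupp.singleAddHom l)) (by
      intro l l'
      ext m
      refine (QuotientAddGroup.eq_iff_sub_mem).2 (AddSubgroup.subset_closure
        ⟨Finsupp.single (l + l') 1 - (Finsupp.single l 1 + Finsupp.single l' 1), m, ?_, ?_⟩)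
      · rw [hsub, hadd, hs, hs, hs]; simp
      · simp)
  obtain ⟨φ, hφ⟩ := exists_lift b (by
    intro l r m
    refine (QuotientAddGroup.eq_iff_sub_mem).2 (AddSubgroup.subset_closure
        ⟨Finsupp.single (MulOpposite.op r • l) 1 - Finsupp.single l r, m, ?_, ?_⟩)
    · rw [hsub, hs, hs]; simp
    · simp)
  have hg : g ∈ N := by
    rw [← QuotientAddGroup.eq_zero_iff, ← map_zero φ, ← h, map_finsuppSum]
    simp only [hφ]
    conv_lhs => rw [← Finsupp.sum_single g]
    exact map_finsuppSum (QuotientAddGroup.mk' N) g _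
  clear h
  induction hg using AddSubgroup.closure_induction with
  | mem x hx =>
    obtain ⟨a, m, ha, rfl⟩ := hx
    exact ⟨1, fun _ => a, fun _ => m, fun _ => ha, by simp⟩
  | zero => exact ⟨0, Fin.elim0, Fin.elim0, fun j => j.elim0, by simp⟩
  | add x y _ _ hx hy =>
    obtain ⟨n, a, m, ha, rfl⟩ := hx
    obtain ⟨n', a', m', ha', rfl⟩ := hy
    refine ⟨n + n', Fin.append a a', Fin.append m m', fun j => ?_, by simp [Fin.sum_univ_add]⟩
    induction j using Fin.addCases with
    | left j => simpa using ha j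
    | right j => simpa using ha' j
  | neg x _ hx =>
    obtain ⟨n, a, m, ha, rfl⟩ := hx
    exact ⟨n, fun j => - a j, m, fun j => by rw [hneg, ha, neg_zero], by simp⟩

end RingTensor

/-! ### The equational criterion for flatness -/

section FlatQuotient

variable {R M : Type*} [Ring R] [AddCommGroup M] [Module R M]

/-- Finitely many relations can be trivialized simultaneously. -/
theorem Submodule.FlatQuotient.exists_factorization (h : (⊥ : Submodule R M).FlatQuotient)
    {n : ℕ} (s : Finset (Fin n → R)) (m : Fin n → M) (hs : ∀ r ∈ s, ∑ i, r i • m i = 0) :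
    ∃ (p : ℕ) (a : Fin n → Fin p → R) (m' : Fin p → M),
      (∀ i, m i = ∑ j, a i j • m' j) ∧ ∀ r ∈ s, ∀ j, ∑ i, r i * a i j = 0 := by
  classical
  induction s using Finset.induction_on with
  | empty =>
    exact ⟨n, fun i j => if i = j then 1 else 0, m, fun i => by simp [ite_smul], by simp⟩
  | insert r s _ ih =>
    obtain ⟨p, a, m', hm, ha⟩ := ih fun r hr => hs r (Finset.mem_insert_of_mem hr)
    obtain ⟨q, b, m'', hb, hr⟩ := h p (fun j => ∑ i, r i * a i j) m' (by
      rw [Submodule.mem_bot, ← hs r (Finset.mem_insert_self r s)]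
      simp only [hm, Finset.sum_smul, Finset.smul_sum, smul_smul]
      exact Finset.sum_comm)
    simp only [Submodule.mem_bot, sub_eq_zero] at hb
    refine ⟨q, fun i k => ∑ j, a i j * b j k, m'', fun i => ?_, fun t ht k => ?_⟩
    · rw [hm]
      simp only [hb, Finset.sum_smul, Finset.smul_sum, smul_smul]
      exact Finset.sum_comm
    · have : ∑ i, t i * ∑ j, a i j * b j k = ∑ j, (∑ i, t i * a i j) * b j k := by
        simp only [Finset.mul_sum, Finset.sum_mul, mul_assoc]
        exact Finset.sum_comm
      rw [this]
      obtain rfl | ht := Finset.mem_insert.1 ht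
      · exact hr k
      · simp [ha t ht]

-- If `∑ f l ⊗ g l` vanishes, `g` pushed along `f` is a sum of columns `a j` times `m j`. Its
-- coordinates outside the range of `f` are zero, which gives finitely many relations among the `m
-- j`. Trivializing these together rewrites the columns so that they are supported in the range of
-- `f`, and they pull back to vanishing combinations in `L`.
open RingTensor in
theorem isFlatModule_of_flatQuotient_bot {R M : Type u} [Ring R] [AddCommGroup M] [Module R M]
    (h : (⊥ : Submodule R M).FlatQuotient) : IsFlatModule R M := by
  classical
  intro L L' _ _ _ _ f hf
  rw [injective_iff_map_eq_zero]
  intro t ht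
  obtain ⟨g, rfl⟩ := exists_finsupp t
  have hg : ((g.mapDomain f).sum fun l m => (tmul l m : RingTensor R L' M)) = 0 := by
    rw [Finsupp.sum_mapDomain_index (fun l => (tmulHom l).map_zero)
      (fun l => (tmulHom l).map_add), ← ht, map_finsuppSum]
    rfl
  obtain ⟨n, a, m, ha, hga⟩ := exists_columns_of_sum_tmul_eq_zero _ hg
  let s : Finset L' := (Finset.univ.biUnion fun j => (a j).support).filter (· ∉ Set.range f)
  obtain ⟨p, b, m', hm, hb⟩ := h.exists_factorization (s.image fun x j => a j x) m (by
    simp only [Finset.mem_image, forall_exists_index, and_imp, forall_apply_eq_imp_iff₂]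
    intro x hx
    have hx' : x ∉ Set.range f := (Finset.mem_filter.1 hx).2
    have := DFunLike.congr_fun hga x
    rw [Finsupp.mapDomain_of_notMem_range _ _ hx'] at this
    simpa using this.symm)
  let c : Fin p → L' →₀ R := fun k => ∑ j, (a j).mapRange (fun r => r * b j k) (zero_mul _)
  have hc : ∀ k x, c k x = ∑ j, a j x * b j k := fun k x => by simp [c]
  -- The new columns vanish off the range of `f`: these are exactly the relations that `b` was
  -- chosen to kill.
  have hrange : ((c · ·) : Fin p → L' → R) = fun k => Set.indicator (Set.range f) (c k) := by
    funext k x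
    by_cases hx : x ∈ Set.range f
    · rw [Set.indicator_of_mem hx]
    rw [Set.indicator_of_notMem hx, hc]
    by_cases hxs : ∃ j, a j x ≠ 0
    · exact hb _ (Finset.mem_image_of_mem _ (Finset.mem_filter.2
        ⟨by simpa using hxs, hx⟩)) k
    · push Not at hxs
      simp [hxs]
  have hd : ∀ k, ((c k).comapDomain f hf.injOn).mapDomain f = c k := fun k =>
    Finsupp.mapDomain_comapDomain f hf (c k) fun x hx => by
      by_contra hx'
      have := congrFun (congrFun hrange k) x
      rw [Set.indicator_of_notMem hx'] at this
      exact Finsupp.mem_support_iff.1 hx this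
  have hzero : ∀ k, (((c k).comapDomain f hf.injOn).sum fun l r => MulOpposite.op r • l) = 0 := by
    intro k
    apply hf
    rw [map_zero, map_finsuppSum]
    have h1 : ((c k).sum fun l r => MulOpposite.op r • l) = 0 := by
      rw [← Finsupp.sum_finsetSum_index (by simp) (by simp [add_smul])]
      refine Finset.sum_eq_zero fun j _ => ?_
      rw [Finsupp.sum_mapRange_index (by simp)]
      simp only [MulOpposite.op_mul, mul_smul, ← Finsupp.smul_sum, ha, smul_zero]
    rw [← h1]
    conv_rhs => rw [← hd k]
    rw [Finsupp.sum_mapDomain_index (by simp) (by simp [add_smul])]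
    simp
  have hgd : g = ∑ k, column ((c k).comapDomain f hf.injOn) (m' k) := by
    ext l
    have := DFunLike.congr_fun hga (f l)
    rw [Finsupp.mapDomain_apply hf] at this
    rw [this]
    simp only [Finsupp.finsetSum_apply, column_apply, Finsupp.comapDomain_apply, hc, hm,
      Finset.smul_sum, Finset.sum_smul, smul_smul]
    exact Finset.sum_comm
  rw [hgd, ← Finsupp.sum_finsetSum_index (fun l => (tmulHom l).map_zero)
      (fun l => (tmulHom l).map_add)]
  refine Finset.sum_eq_zero fun k _ => ?_
  rw [sum_column, hzero]
  exact DFunLike.congr_fun (map_zero tmulHom) (m' k)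

-- The row `r` induces an injection of right modules `Rⁿ/ker φ → R`. The tensor `∑ eᵢ ⊗ mᵢ` dies in
-- `R ⊗ M`, hence already in `(Rⁿ/ker φ) ⊗ M`. Mapping that group to `Mⁿ/(ker φ · M)` shows that `m`
-- is a finite sum of vectors `k · m'` with `k ∈ ker φ`; these `k` are the columns of `a`.
open RingTensor in
theorem flatQuotient_bot_of_isFlatModule {R M : Type u} [Ring R] [AddCommGroup M] [Module R M]
    (h : IsFlatModule R M) : (⊥ : Submodule R M).FlatQuotient := by
  classical
  intro n r m hm
  rw [Submodule.mem_bot] at hm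
  let φ : (Fin n → R) →ₗ[Rᵐᵒᵖ] R :=
    { toFun := fun v => ∑ i, r i * v i
      map_add' := by simp [mul_add, Finset.sum_add_distrib]
      map_smul' := by simp [Finset.sum_mul, mul_assoc] }
  let f : ((Fin n → R) ⧸ φ.ker) →ₗ[Rᵐᵒᵖ] R := φ.ker.liftQ φ le_rfl
  have hf : Function.Injective f := LinearMap.ker_eq_bot.1 (Submodule.ker_liftQ_eq_bot _ _ _ le_rfl)
  let H : AddSubgroup (Fin n → M) := AddSubgroup.closure
    {x | ∃ k ∈ φ.ker, ∃ m : M, x = fun i => k i • m}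
  let b₀ : (Fin n → R) →+ M →+ (Fin n → M) ⧸ H := AddMonoidHom.mk'
    (fun v => (QuotientAddGroup.mk' H).comp
      (AddMonoidHom.mk' (fun m i => v i • m) fun m m' => by ext i; simp)) (by
      intro v w
      ext m
      simp only [AddMonoidHom.comp_apply, AddMonoidHom.add_apply, ← map_add]
      congr 1
      ext i
      simp [add_smul])
  let b : ((Fin n → R) ⧸ φ.ker) →+ M →+ (Fin n → M) ⧸ H :=
    QuotientAddGroup.lift φ.ker.toAddSubgroup b₀ (by
      intro k hk
      ext m
      exact (QuotientAddGroup.eq_zero_iff _).2 (AddSubgroup.subset_closure ⟨k, hk, m, rfl⟩))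
  have hb : ∀ v m, b (φ.ker.mkQ v) m = QuotientAddGroup.mk' H fun i => v i • m :=
    fun v m => rfl
  obtain ⟨ψ, hψ⟩ := exists_lift b (by
    intro l s m
    obtain ⟨v, rfl⟩ := φ.ker.mkQ_surjective l
    rw [← map_smul, hb, hb]
    simp [mul_smul])
  have ht : ∑ i, (tmul (φ.ker.mkQ (Pi.single i 1)) (m i) :
      RingTensor R ((Fin n → R) ⧸ φ.ker) M) = 0 := by
    apply h _ _ f hf
    have : ∀ i, f (φ.ker.mkQ (Pi.single i 1)) = MulOpposite.op (r i) • (1 : R) := fun i => by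
      simp [f, φ, Pi.single_apply]
    simp only [map_sum, map_tmul, this, op_smul_tmul, map_zero]
    exact (map_sum (tmulHom (R := R) (M := M) (1 : R)) _ _).symm.trans (by rw [hm, map_zero])
  have hH : m ∈ H := by
    rw [← QuotientAddGroup.eq_zero_iff, ← map_zero ψ, ← ht, map_sum]
    simp only [hψ, hb]
    rw [← map_sum]
    refine congrArg (QuotientAddGroup.mk' H) ?_
    ext i
    simp [Pi.single_apply, ite_smul]
  have key : ∃ (p : ℕ) (a : Fin n → Fin p → R) (m' : Fin p → M),
      (∀ i, m i = ∑ j, a i j • m' j) ∧ ∀ j, ∑ i, r i * a i j = 0 := by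
    clear ht hψ hb hm
    induction hH using AddSubgroup.closure_induction with
    | mem x hx =>
      obtain ⟨k, hk, m, rfl⟩ := hx
      exact ⟨1, fun i _ => k i, fun _ => m, by simp, fun _ => hk⟩
    | zero => exact ⟨0, fun _ => Fin.elim0, Fin.elim0, by simp, fun j => j.elim0⟩
    | add x y _ _ hx hy =>
      obtain ⟨p, a, m, hm, ha⟩ := hx
      obtain ⟨p', a', m', hm', ha'⟩ := hy
      refine ⟨p + p', fun i => Fin.append (a i) (a' i), Fin.append m m',
        by simp [Fin.sum_univ_add, hm, hm'], fun j => ?_⟩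
      induction j using Fin.addCases with
      | left j => simpa using ha j
      | right j => simpa using ha' j
    | neg x _ hx =>
      obtain ⟨p, a, m, hm, ha⟩ := hx
      exact ⟨p, fun i j => - a i j, m, by simp [hm], fun j => by simp [ha]⟩
  simpa [sub_eq_zero] using key

theorem isFlatModule_iff {R M : Type u} [Ring R] [AddCommGroup M] [Module R M] :
    IsFlatModule R M ↔ (⊥ : Submodule R M).FlatQuotient :=
  ⟨flatQuotient_bot_of_isFlatModule, isFlatModule_of_flatQuotient_bot⟩

/-- Allows flatness of a quotient to be tested by elements of the ambient module, where it is
compatible with unions of submodules. -/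
theorem isFlatModule_quotient_iff {R M : Type u} [Ring R] [AddCommGroup M] [Module R M]
    (N : Submodule R M) : IsFlatModule R (M ⧸ N) ↔ N.FlatQuotient := by
  have key : ∀ x, N.mkQ x = 0 ↔ x ∈ N := fun x => Submodule.Quotient.mk_eq_zero N
  rw [isFlatModule_iff]
  constructor
  · intro h n r m hm
    obtain ⟨p, a, m', h1, h2⟩ := h n r (fun i => N.mkQ (m i)) (by
      simpa only [Submodule.mem_bot, ← key, map_sum, map_smul] using hm)
    choose m'' hm'' using fun j => N.mkQ_surjective (m' j)
    refine ⟨p, a, m'', fun i => ?_, h2⟩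
    simpa only [Submodule.mem_bot, ← key, map_sum, map_smul, map_sub, hm''] using h1 i
  · intro h n r m hm
    choose m₀ hm₀ using fun i => N.mkQ_surjective (m i)
    obtain rfl : (fun i => N.mkQ (m₀ i)) = m := funext hm₀
    obtain ⟨p, a, m', h1, h2⟩ := h n r m₀ (by
      simpa only [Submodule.mem_bot, ← key, map_sum, map_smul] using hm)
    refine ⟨p, a, fun j => N.mkQ (m' j), fun i => ?_, h2⟩
    simpa only [Submodule.mem_bot, ← key, map_sum, map_smul, map_sub] using h1 i

theorem Submodule.FlatQuotient.of_surjective {M' : Type*} [AddCommGroup M'] [Module R M']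
    (f : M →ₗ[R] M') (hf : Function.Surjective f) {N : Submodule R M'}
    (h : N.FlatQuotient) : (N.comap f).FlatQuotient := by
  intro n r m hm
  obtain ⟨p, a, m', h1, h2⟩ := h n r (fun i => f (m i)) (by simpa using hm)
  choose m₀ hm₀ using fun j => hf (m' j)
  refine ⟨p, a, m₀, fun i => ?_, h2⟩
  simpa [hm₀] using h1 i

end FlatQuotient

/-! ### `Ext¹` as a lifting problem -/

section Ext
variable {C : Type u} [Category.{v} C] [Abelian C]

/-- Long exact sequence for `Ext(X, -)`: since `Ext¹(X, S.X₂) = 0`, the group `Ext¹(X, S.X₁)` is the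
cokernel of `Hom(X, S.X₂) → Hom(X, S.X₃)`. -/
theorem subsingleton_ext_one_iff [HasExt.{w} C] {S : ShortComplex C} (hS : S.ShortExact)
    [Injective S.X₂] (X : C) :
    Subsingleton (Abelian.Ext.{w} X S.X₁ 1) ↔ ∀ g : X ⟶ S.X₃, ∃ h : X ⟶ S.X₂, h ≫ S.g = g := by
  constructor
  · intro _ g
    obtain ⟨x₂, hx₂⟩ := Abelian.Ext.covariant_sequence_exact₃ (S := S) X hS
      (Abelian.Ext.mk₀ g) (zero_add 1) (Subsingleton.elim _ _)
    obtain ⟨h, rfl⟩ := (Abelian.Ext.mk₀_bijective X S.X₂).2 x₂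
    refine ⟨h, (Abelian.Ext.mk₀_bijective X S.X₃).1 ?_⟩
    rw [← hx₂, Abelian.Ext.mk₀_comp_mk₀]
  · intro H
    refine subsingleton_of_forall_eq 0 fun x => ?_
    obtain ⟨x₃, rfl⟩ := Abelian.Ext.covariant_sequence_exact₁ (S := S) X hS x
      (Abelian.Ext.eq_zero_of_injective _) (zero_add 1)
    obtain ⟨g, rfl⟩ := (Abelian.Ext.mk₀_bijective X S.X₃).2 x₃
    obtain ⟨h, rfl⟩ := H g
    rw [← Abelian.Ext.mk₀_comp_mk₀, Abelian.Ext.comp_assoc_of_second_deg_zero]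
    simp

end Ext

/-! ### Enough injectives -/

section Rep
variable {J : Type u} [Category.{u} J] (R : Type u) [Ring R]

-- The right adjoint of evaluation at `j` preserves injectives. The product over `j` of the
-- representations coinduced from injective hulls-over `M.obj j` receives a map from `M` that is
-- injective at each object.
open Limits in
instance functor_enoughInjectives : EnoughInjectives (J ⥤ ModuleCat.{u} R) where
  presentation M := ⟨by
    let I : J → (J ⥤ ModuleCat.{u} R) := fun j =>
      (evaluationRightAdjoint (ModuleCat.{u} R) j).obj (Injective.under (M.obj j))
    have : ∀ j, Injective (I j) := fun j =>
      Injective.injective_of_adjoint (evaluationAdjunctionLeft (ModuleCat.{u} R) j) _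
    let e : ∀ j, M ⟶ I j := fun j =>
      (evaluationAdjunctionLeft (ModuleCat.{u} R) j).homEquiv _ _ (Injective.ι (M.obj j))
    refine ⟨∏ᶜ I, inferInstance, Pi.lift e, ?_⟩
    have : ∀ j, Mono ((Pi.lift e).app j) := fun j => by
      have h : (Pi.lift e).app j ≫ (Pi.π I j).app j ≫
          (evaluationAdjunctionLeft (ModuleCat.{u} R) j).counit.app _ = Injective.ι (M.obj j) := by
        rw [← NatTrans.comp_app_assoc, Pi.lift_π]
        exact ((evaluationAdjunctionLeft (ModuleCat.{u} R) j).homEquiv_counit _ _ _).symm.trans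
          (Equiv.symm_apply_apply _ _)
      exact mono_of_mono_fac h
    exact NatTrans.mono_of_mono_app _⟩

end Rep

/-! ### Subrepresentations and quotients -/

/-- A subrepresentation of a functor to modules. -/
structure Subrep {J : Type u} [Category.{u} J] {R : Type u} [Ring R]
    (M : J ⥤ ModuleCat.{u} R) where
  /-- The submodule at each object. -/
  carrier : ∀ j, Submodule R (M.obj j)
  map_mem : ∀ {i j : J} (f : i ⟶ j) (x : M.obj i), x ∈ carrier i → M.map f x ∈ carrier j

namespace Subrep

variable {J : Type u} [Category.{u} J] {R : Type u} [Ring R] {M : J ⥤ ModuleCat.{u} R}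

/-- A subrepresentation as a representation. -/
def toRep (S : Subrep M) : J ⥤ ModuleCat.{u} R where
  obj j := ModuleCat.of R (S.carrier j)
  map f := ModuleCat.ofHom ((M.map f).hom.restrict (S.map_mem f))

/-- The inclusion of a subrepresentation. -/
def ι (S : Subrep M) : S.toRep ⟶ M where
  app j := ModuleCat.ofHom (S.carrier j).subtype

/-- The quotient by a subrepresentation. -/
def quotient (S : Subrep M) : J ⥤ ModuleCat.{u} R where
  obj j := ModuleCat.of R (M.obj j ⧸ S.carrier j)
  map f := ModuleCat.ofHom ((S.carrier _).mapQ (S.carrier _) (M.map f).hom (S.map_mem f))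

/-- The quotient map. -/
def π (S : Subrep M) : M ⟶ S.quotient where
  app j := ModuleCat.ofHom (S.carrier j).mkQ

/-- The preimage of a subrepresentation. -/
def comap {N : J ⥤ ModuleCat.{u} R} (φ : M ⟶ N) (S : Subrep N) : Subrep M where
  carrier j := (S.carrier j).comap (φ.app j).hom
  map_mem f x hx := by
    have : φ.app _ (M.map f x) = N.map f (φ.app _ x) := NatTrans.naturality_apply φ f x
    exact (congrArg (· ∈ S.carrier _) this).mpr (S.map_mem f _ hx)

instance (S : Subrep M) : Mono S.ι := by
  have : ∀ j, Mono (S.ι.app j) := fun j =>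
    (ModuleCat.mono_iff_injective _).2 (S.carrier j).injective_subtype
  exact NatTrans.mono_of_mono_app _

end Subrep

section Representation

variable {J : Type u} [Category.{u} J] {R : Type u} [Ring R]

/-- A morphism of representations descends along a componentwise surjective morphism. -/
theorem exists_desc_of_surjective {A B Q : J ⥤ ModuleCat.{u} R} (q : A ⟶ B)
    (hq : ∀ j, Function.Surjective (q.app j)) (g : A ⟶ Q)
    (hg : ∀ j x, q.app j x = 0 → g.app j x = 0) : ∃ d : B ⟶ Q, q ≫ d = g := by
  have : ∀ j, Epi (q.app j) := fun j => (ModuleCat.epi_iff_surjective _).2 (hq j)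
  have : Epi q := NatTrans.epi_of_epi_app _
  refine ⟨Abelian.epiDesc q g ?_, Abelian.comp_epiDesc _ _ _⟩
  ext j x
  refine hg j _ ?_
  have : (Limits.kernel.ι q ≫ q).app j = 0 := by rw [Limits.kernel.condition]; rfl
  exact congrArg (fun f => f.hom x) this

/-! ### Small pure subrepresentations by closure under solutions of linear systems -/

variable (J R) in
/-- The language whose function symbols choose solutions of finite systems of linear equations
`A x = B y` in a representation. -/
def linearSystemLanguage : FirstOrder.Language.{u, u} where
  Functions l := Σ v : J, Σ k n : ℕ,
    (Fin k → Fin n → R) × (Fin k → Fin l → R) × (Fin l → Σ w : J, (w ⟶ v)) × Fin n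
  Relations _ := PEmpty

theorem Cardinal.mk_sigma_le_of_le {ι : Type u} {α : ι → Type u} {κ : Cardinal.{u}}
    (hκ : ℵ₀ ≤ κ) (hι : #ι ≤ κ) (hα : ∀ i, #(α i) ≤ κ) : #(Σ i, α i) ≤ κ := by
  rw [mk_sigma]
  exact (sum_le_sum _ _ hα).trans (by
    rw [sum_const']; exact (mul_le_mul' hι le_rfl).trans (mul_eq_self hκ).le)

theorem Cardinal.mk_sigma_nat_le_of_le {α : ℕ → Type u} {κ : Cardinal.{u}}
    (hκ : ℵ₀ ≤ κ) (hα : ∀ i, #(α i) ≤ κ) : #(Σ i, α i) ≤ κ := by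
  have := Cardinal.mk_congr (Equiv.sigmaCongrLeft' (β := α) (Equiv.ulift.{u}.symm))
  rw [this]
  exact mk_sigma_le_of_le hκ (by simpa using hκ) fun i => hα _

theorem Cardinal.mk_fin_arrow_le {α : Type u} {κ : Cardinal.{u}} (hκ : ℵ₀ ≤ κ) (hα : #α ≤ κ)
    (n : ℕ) : #(Fin n → α) ≤ κ := by
  rw [mk_arrow]; simp
  exact (power_le_power_right hα).trans (power_nat_le hκ)

theorem Cardinal.mk_prod_le {α β : Type u} {κ : Cardinal.{u}} (hκ : ℵ₀ ≤ κ) (hα : #α ≤ κ)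
    (hβ : #β ≤ κ) : #(α × β) ≤ κ := by
  rw [mk_prod]; simp
  exact (mul_le_mul' hα hβ).trans (mul_eq_self hκ).le

omit [Ring R] in
theorem mk_linearSystemLanguage_functions_le {κ : Cardinal.{u}} (hκ : ℵ₀ ≤ κ) (hR : #R ≤ κ)
    (hJ : #J ≤ κ) (hE : #(Σ a b : J, (a ⟶ b)) ≤ κ) :
    #(Σ l, (linearSystemLanguage J R).Functions l) ≤ κ := by
  refine mk_sigma_nat_le_of_le hκ fun l => mk_sigma_le_of_le hκ hJ fun v =>
    mk_sigma_nat_le_of_le hκ fun k => mk_sigma_nat_le_of_le hκ fun n => ?_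
  have hv : #(Σ w : J, (w ⟶ v)) ≤ κ := by
    refine le_trans (mk_le_of_injective (f := fun z : Σ w : J, (w ⟶ v) =>
      (⟨z.1, v, z.2⟩ : Σ a b : J, (a ⟶ b))) ?_) hE
    rintro ⟨a, f⟩ ⟨b, g⟩ h
    obtain ⟨rfl, h⟩ := Sigma.mk.inj h
    obtain rfl := eq_of_heq (Sigma.mk.inj (eq_of_heq h)).2
    rfl
  have hn : #(ULift.{u} (Fin n)) ≤ κ := by simpa using natCast_lt_aleph0.le.trans hκ
  refine le_trans (mk_congr (Equiv.prodCongr (Equiv.refl _) (Equiv.prodCongr (Equiv.refl _)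
    (Equiv.prodCongr (Equiv.refl _) Equiv.ulift.{u}.symm)))).le ?_
  exact mk_prod_le hκ (mk_fin_arrow_le hκ (mk_fin_arrow_le hκ hR n) k)
    (mk_prod_le hκ (mk_fin_arrow_le hκ (mk_fin_arrow_le hκ hR l) k)
      (mk_prod_le hκ (mk_fin_arrow_le hκ hv l) hn))

-- Inputs are transported to `v` along the arrows of the symbol, and the output is one coordinate of
-- a chosen solution. The value for unsolvable or ill-typed input is an arbitrary default.
open Classical in
noncomputable instance (M : J ⥤ ModuleCat.{u} R) : (linearSystemLanguage J R).Structure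
    (Σ j, M.obj j) where
  funMap := fun ⟨v, _, n, A, B, f, j⟩ ω =>
    if h : ∃ x : Fin n → M.obj v, ∃ t : ∀ i, M.obj (f i).1, (∀ i, ω i = ⟨_, t i⟩) ∧
      ∀ e, ∑ j, A e j • x j = ∑ i, B e i • M.map (f i).2 (t i) then ⟨v, h.choose j⟩ else ⟨v, 0⟩
  RelMap := fun r => r.elim

theorem exists_solution_mem {M : J ⥤ ModuleCat.{u} R}
    (S : (linearSystemLanguage J R).Substructure (Σ j, M.obj j))
    {v : J} {k n l : ℕ} (A : Fin k → Fin n → R) (B : Fin k → Fin l → R)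
    (w : Fin l → J) (f : ∀ i, w i ⟶ v) (t : ∀ i, M.obj (w i)) (ht : ∀ i, ⟨w i, t i⟩ ∈ S)
    (h : ∃ x : Fin n → M.obj v, ∀ e, ∑ j, A e j • x j = ∑ i, B e i • M.map (f i) (t i)) :
    ∃ x : Fin n → M.obj v, (∀ j, ⟨v, x j⟩ ∈ S) ∧
      ∀ e, ∑ j, A e j • x j = ∑ i, B e i • M.map (f i) (t i) := by
  have h' : ∃ x : Fin n → M.obj v, ∃ t' : ∀ i, M.obj (w i),
      (∀ i, (⟨w i, t i⟩ : Σ j, M.obj j) = ⟨_, t' i⟩) ∧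
      ∀ e, ∑ j, A e j • x j = ∑ i, B e i • M.map (f i) (t' i) := by
    obtain ⟨x, hx⟩ := h
    exact ⟨x, t, fun _ => rfl, hx⟩
  refine ⟨h'.choose, fun j => ?_, ?_⟩
  · let o : (linearSystemLanguage J R).Functions l := ⟨v, k, n, A, B, fun i => ⟨w i, f i⟩, j⟩
    have e : FirstOrder.Language.Structure.funMap o (fun i => (⟨w i, t i⟩ : Σ j, M.obj j)) =
        ⟨v, h'.choose j⟩ := dif_pos h'
    have := S.fun_mem o (fun i => ⟨w i, t i⟩) ht
    rwa [e] at this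
  · obtain ⟨t', ht', hx⟩ := h'.choose_spec
    obtain rfl : t = t' := funext fun i => eq_of_heq (Sigma.mk.inj (ht' i)).2
    exact hx

/-- One-equation systems make the closure of `x` a subrepresentation; solvability inside it of
systems solvable in `M` passes flatness on to both it and its quotient. -/
theorem exists_small_pure_subrep {κ : Cardinal.{u}} (hκ : ℵ₀ ≤ κ) (hR : #R ≤ κ)
    (hJ : #J ≤ κ) (hE : #(Σ a b : J, (a ⟶ b)) ≤ κ) {M : J ⥤ ModuleCat.{u} R}
    (hM : ∀ j, (⊥ : Submodule R (M.obj j)).FlatQuotient) (i : J) (x : M.obj i) :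
    ∃ S : Subrep M, x ∈ S.carrier i ∧ #(Σ j, S.carrier j) ≤ κ ∧
      (∀ j, (⊥ : Submodule R (S.carrier j)).FlatQuotient) ∧ ∀ j, (S.carrier j).FlatQuotient := by
  let T : (linearSystemLanguage J R).Substructure (Σ j, M.obj j) :=
    FirstOrder.Language.Substructure.closure _ {⟨i, x⟩}
  have hT : #T ≤ κ := by
    have := FirstOrder.Language.Substructure.lift_card_closure_le
      (L := linearSystemLanguage J R) (s := ({⟨i, x⟩} : Set (Σ j, M.obj j)))
    simp only [lift_id] at this
    refine this.trans (max_le hκ (add_le_of_le hκ ?_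
      (mk_linearSystemLanguage_functions_le hκ hR hJ hE)))
    simpa using one_le_aleph0.trans hκ
  have hsys : ∀ {v : J} {k n l : ℕ} (A : Fin k → Fin n → R) (B : Fin k → Fin l → R)
      (t : Fin l → M.obj v) (_ : ∀ i, ⟨v, t i⟩ ∈ T) (x : Fin n → M.obj v)
      (_ : ∀ e, ∑ j, A e j • x j = ∑ i, B e i • t i), ∃ x : Fin n → M.obj v,
      (∀ j, ⟨v, x j⟩ ∈ T) ∧ ∀ e, ∑ j, A e j • x j = ∑ i, B e i • t i := by
    intro v k n l A B t ht x hx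
    simpa using exists_solution_mem T A B (fun _ => v) (fun _ => 𝟙 v) t ht ⟨x, by simpa using hx⟩
  have hone : ∀ {v : J} {l : ℕ} (B : Fin l → R) (t : Fin l → M.obj v)
      (_ : ∀ i, ⟨v, t i⟩ ∈ T), ⟨v, ∑ i, B i • t i⟩ ∈ T := by
    intro v l B t ht
    obtain ⟨x, hx, h⟩ := hsys (k := 1) (n := 1) (fun _ _ => 1) (fun _ => B) t ht
      (fun _ => ∑ i, B i • t i) (by simp)
    have := h 0
    simp only [Finset.univ_unique, Finset.sum_singleton, one_smul] at this
    exact this ▸ hx _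
  let S : Subrep M :=
    { carrier := fun j =>
        { carrier := {y | ⟨j, y⟩ ∈ T}
          add_mem' := fun {a b} ha hb => by
            simpa using hone (![1, 1]) ![a, b] (by simpa [Fin.forall_fin_two] using ⟨ha, hb⟩)
          zero_mem' := by simpa using hone (v := j) Fin.elim0 Fin.elim0 (fun i => i.elim0)
          smul_mem' := fun r a ha => by simpa using hone (fun _ : Fin 1 => r) ![a] (by simpa using ha) }
      map_mem := fun {a b} f y hy => by
        obtain ⟨x, hx, h⟩ := exists_solution_mem T (k := 1) (n := 1) (l := 1)
          (fun _ _ => 1) (fun _ _ => 1) (fun _ => a) (fun _ => f) (fun _ => y) (fun _ => hy)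
          ⟨fun _ => M.map f y, by simp⟩
        have := h 0
        simp only [Finset.univ_unique, Finset.sum_singleton, one_smul] at this
        exact this ▸ hx _ }
  have hS : ∀ {j} {y : M.obj j}, y ∈ S.carrier j ↔ ⟨j, y⟩ ∈ T := Iff.rfl
  refine ⟨S, FirstOrder.Language.Substructure.subset_closure rfl, ?_, fun v => ?_, fun v => ?_⟩
  · refine le_trans (mk_le_of_injective (f := fun z : Σ j, S.carrier j =>
      (⟨⟨z.1, z.2.1⟩, z.2.2⟩ : T)) ?_) hT
    rintro ⟨a, y, hy⟩ ⟨b, z, hz⟩ h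
    obtain ⟨rfl, h⟩ := Sigma.mk.inj (Subtype.ext_iff.1 h)
    obtain rfl := eq_of_heq h
    rfl
  · intro n r m hm
    obtain ⟨p, a, m', h1, h2⟩ := hM v n r (fun i => (m i : M.obj v)) (by
      simpa using congrArg Subtype.val hm)
    simp only [Submodule.mem_bot, sub_eq_zero] at h1
    -- The system `∑ⱼ aᵢⱼ xⱼ = mᵢ` has the solution `m'` in `M`, hence one in `S`; the scalars `a`
    -- stay the same.
    obtain ⟨x, hx, h⟩ := hsys a (fun i j => if i = j then 1 else 0) (fun i => (m i : M.obj v))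
      (fun i => (m i).2) m' (fun i => by simp [h1, ite_smul])
    refine ⟨p, a, fun j => ⟨x j, hx j⟩, fun i => ?_, h2⟩
    rw [Submodule.mem_bot, sub_eq_zero]
    apply Subtype.ext
    simpa [ite_smul] using (h i).symm
  · intro n r m hm
    -- Solve `∑ rᵢ xᵢ = ∑ rᵢ mᵢ` inside `S`. Then `m - x` satisfies a homogeneous relation in the
    -- flat module, and `m ≡ m - x` modulo `S`.
    obtain ⟨x, hx, h⟩ := hsys (k := 1) (l := 1) (fun _ => r) (fun _ _ => 1)
      (fun _ => ∑ i, r i • m i) (fun _ => hm) m (by simp)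
    have h0 : ∑ i, r i • x i = ∑ i, r i • m i := by simpa using h 0
    obtain ⟨p, a, m', h1, h2⟩ := hM v n r (fun i => m i - x i) (by simp [smul_sub, h0])
    refine ⟨p, a, m', fun i => ?_, h2⟩
    have := h1 i
    rw [Submodule.mem_bot, sub_sub, add_comm, ← sub_sub, sub_eq_zero] at this
    rw [this]
    exact hx i

/-! ### Extending partial lifts by Zorn's lemma -/

/-- A partial lift of `g : F ⟶ Q` along `p : I ⟶ Q`, defined on a subrepresentation of `F` with
componentwise flat quotient. -/
structure IsFlatPartialLift {F I Q : J ⥤ ModuleCat.{u} R} (p : I ⟶ Q) (g : F ⟶ Q)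
    (f : ∀ j, F.obj j →ₗ.[R] I.obj j) : Prop where
  natural : ∀ {i j : J} (a : i ⟶ j) (x : (f i).domain), ∃ y : (f j).domain,
    (y : F.obj j) = F.map a (x : F.obj i) ∧ f j y = I.map a (f i x)
  lift : ∀ j (x : (f j).domain), p.app j (f j x) = g.app j (x : F.obj j)
  flat : ∀ j, (f j).domain.FlatQuotient

namespace IsFlatPartialLift

variable {F I Q : J ⥤ ModuleCat.{u} R} {p : I ⟶ Q} {g : F ⟶ Q}

theorem bot (hF : ∀ j, (⊥ : Submodule R (F.obj j)).FlatQuotient) :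
    IsFlatPartialLift p g fun _ => ⊥ where
  natural := by
    rintro i j a ⟨x, hx⟩
    obtain rfl := (Submodule.mem_bot R).1 hx
    exact ⟨0, by simp, by
      rw [show (⟨0, hx⟩ : (⊥ : F.obj i →ₗ.[R] I.obj i).domain) = 0 from rfl]; simp⟩
  lift := by
    rintro j ⟨x, hx⟩
    obtain rfl := (Submodule.mem_bot R).1 hx
    rw [show (⟨0, hx⟩ : (⊥ : F.obj j →ₗ.[R] I.obj j).domain) = 0 from rfl]
    simp
  flat := hF

theorem exists_upperBound {c : Set (∀ j, F.obj j →ₗ.[R] I.obj j)}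
    (hc : ∀ f ∈ c, IsFlatPartialLift p g f) (hchain : IsChain (· ≤ ·) c) (hne : c.Nonempty) :
    ∃ f, IsFlatPartialLift p g f ∧ ∀ f' ∈ c, f' ≤ f := by
  have hdir : ∀ j, DirectedOn (· ≤ ·) ((fun f => f j) '' c) := by
    rintro j _ ⟨f, hf, rfl⟩ _ ⟨f', hf', rfl⟩
    obtain ⟨h, hh, h1, h2⟩ := hchain.directedOn f hf f' hf'
    exact ⟨h j, ⟨h, hh, rfl⟩, h1 j, h2 j⟩
  have hle : ∀ f ∈ c, ∀ j, f j ≤ LinearPMap.sSup _ (hdir j) := fun f hf j =>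
    LinearPMap.le_sSup _ ⟨f, hf, rfl⟩
  have hmem : ∀ j x, x ∈ (LinearPMap.sSup _ (hdir j)).domain ↔ ∃ f ∈ c, x ∈ (f j).domain := by
    intro j x
    rw [LinearPMap.mem_domain_sSup_iff (hne.image _)]
    simp
  have happ : ∀ f (hf : f ∈ c) j (x : (f j).domain),
      LinearPMap.sSup _ (hdir j) ⟨x, (hle f hf j).1 x.2⟩ = f j x := fun f hf j x =>
    ((hle f hf j).2 rfl).symm
  refine ⟨fun j => LinearPMap.sSup _ (hdir j), ⟨?_, ?_, ?_⟩, hle⟩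
  · rintro i j a ⟨x, hx⟩
    obtain ⟨f, hf, hx'⟩ := (hmem i x).1 hx
    obtain ⟨y, hy, hy'⟩ := (hc f hf).natural a ⟨x, hx'⟩
    exact ⟨⟨y, (hle f hf j).1 y.2⟩, hy, by rw [happ f hf, hy', ← happ f hf]⟩
  · rintro j ⟨x, hx⟩
    obtain ⟨f, hf, hx'⟩ := (hmem j x).1 hx
    exact (congrArg _ (happ f hf j ⟨x, hx'⟩)).trans ((hc f hf).lift j ⟨x, hx'⟩)
  -- The hypothesis concerns a single element `∑ rᵢ mᵢ`, so it already holds for one member of the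
  -- chain.
  · intro j n r m hm
    obtain ⟨f, hf, hm'⟩ := (hmem j _).1 hm
    obtain ⟨q, a, m', h1, h2⟩ := (hc f hf).flat j n r m hm'
    exact ⟨q, a, m', fun i => (hle f hf j).1 (h1 i), h2⟩

/-- The domain of a partial lift. -/
def domain {f : ∀ j, F.obj j →ₗ.[R] I.obj j} (hf : IsFlatPartialLift p g f) : Subrep F where
  carrier j := (f j).domain
  map_mem a x hx := by
    obtain ⟨y, hy, -⟩ := hf.natural a ⟨x, hx⟩
    exact hy ▸ y.2

/-- A partial lift as a morphism. -/
def hom {f : ∀ j, F.obj j →ₗ.[R] I.obj j} (hf : IsFlatPartialLift p g f) :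
    hf.domain.toRep ⟶ I where
  app j := ModuleCat.ofHom (f j).toFun
  naturality i j a := by
    ext x
    obtain ⟨y, hy, hy'⟩ := hf.natural a x
    refine Eq.trans ?_ hy'
    exact congrArg (f j) (Subtype.ext hy.symm)

theorem of_hom {S : Subrep F} (hS : ∀ j, (S.carrier j).FlatQuotient) (h : S.toRep ⟶ I)
    (hh : h ≫ p = S.ι ≫ g) :
    IsFlatPartialLift p g fun j => ⟨S.carrier j, (h.app j).hom⟩ where
  natural {i _} a x := ⟨⟨F.map a (x : F.obj i), S.map_mem a _ x.2⟩, rfl,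
    NatTrans.naturality_apply h a x⟩
  lift j x := congrArg (fun f => (f.app j).hom x) hh
  flat := hS

/-- With `D` the domain and `D'` the preimage of a small pure `S ⊆ F/D`, first extend the lift to
`h' : D' ⟶ I` by injectivity. The error `h' ≫ p - g` vanishes on `D`, so it factors through the
small flat `S` and lifts to `I`; subtracting this corrects `h'` without changing it on `D`. -/
theorem exists_extension {κ : Cardinal.{u}} (hκ : ℵ₀ ≤ κ) (hR : #R ≤ κ)
    (hJ : #J ≤ κ) (hE : #(Σ a b : J, (a ⟶ b)) ≤ κ) [Injective I]
    (hp : ∀ N : J ⥤ ModuleCat.{u} R, (∀ j, IsFlatModule R (N.obj j)) → #(Σ j, N.obj j) ≤ κ →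
      ∀ g : N ⟶ Q, ∃ h : N ⟶ I, h ≫ p = g)
    {f : ∀ j, F.obj j →ₗ.[R] I.obj j} (hf : IsFlatPartialLift p g f) (i : J) (x : F.obj i) :
    ∃ f', IsFlatPartialLift p g f' ∧ f ≤ f' ∧ x ∈ (f' i).domain := by
  let D := hf.domain
  obtain ⟨S, hx, hSκ, hS, hS'⟩ := exists_small_pure_subrep hκ hR hJ hE (M := D.quotient)
    (fun j => isFlatModule_iff.1 ((isFlatModule_quotient_iff _).2 (hf.flat j))) i (D.π.app i x)
  have hπ : ∀ j (y : F.obj j), D.π.app j y = 0 ↔ y ∈ D.carrier j := fun j y =>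
    Submodule.Quotient.mk_eq_zero _
  have hπs : ∀ j, Function.Surjective (D.π.app j) := fun j => (D.carrier j).mkQ_surjective
  let S' := S.comap D.π
  let k : D.toRep ⟶ S'.toRep :=
    { app := fun j => ModuleCat.ofHom (Submodule.inclusion fun y hy =>
        show D.π.app j y ∈ S.carrier j from ((hπ j y).2 hy).symm ▸ zero_mem _) }
  have hk : k ≫ S'.ι = D.ι := rfl
  have : Mono k := mono_of_mono_fac hk
  let q : S'.toRep ⟶ S.toRep :=
    { app := fun j => ModuleCat.ofHom ((D.π.app j).hom.restrict fun y hy => hy)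
      naturality := fun a b f => by
        ext y
        exact Subtype.ext (NatTrans.naturality_apply D.π f y.1) }
  have hq : ∀ j, Function.Surjective (q.app j) := by
    rintro j ⟨y, hy⟩
    obtain ⟨z, rfl⟩ := hπs j y
    exact ⟨⟨z, hy⟩, rfl⟩
  have hq0 : ∀ j y, q.app j y = 0 → ∃ z, k.app j z = y := by
    rintro j ⟨y, hy⟩ h
    exact ⟨⟨y, (hπ j y).1 (congrArg Subtype.val h)⟩, rfl⟩
  have hkq : k ≫ q = 0 := by
    ext j y
    exact Subtype.ext ((hπ j y.1).2 y.2)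
  have hD : hf.hom ≫ p = D.ι ≫ g := by
    ext j y
    exact hf.lift j y
  let h' : S'.toRep ⟶ I := Injective.factorThru hf.hom k
  have hh' : k ≫ h' = hf.hom := Injective.comp_factorThru _ _
  obtain ⟨d, hd⟩ := exists_desc_of_surjective q hq (h' ≫ p - S'.ι ≫ g) (by
    intro j y hy
    obtain ⟨z, rfl⟩ := hq0 j y hy
    have : k ≫ (h' ≫ p - S'.ι ≫ g) = 0 := by
      rw [Preadditive.comp_sub, ← Category.assoc, hh', ← Category.assoc, hk, hD, sub_self]
    exact congrArg (fun f => (f.app j).hom z) this)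
  obtain ⟨e, he⟩ := hp S.toRep (fun j => isFlatModule_iff.2 (hS j)) hSκ d
  have hS'' : ∀ j, (S'.carrier j).FlatQuotient := fun j => (hS' j).of_surjective _ (hπs j)
  refine ⟨_, of_hom hS'' (h' - q ≫ e) (by
    rw [Preadditive.sub_comp, Category.assoc, he, hd, sub_sub_cancel]), fun j => ⟨?_, ?_⟩, hx⟩
  · intro y hy
    exact (k.app j ⟨y, hy⟩).2
  · rintro ⟨y, hy⟩ ⟨y', hy'⟩ (rfl : y = y')
    have : hf.hom = k ≫ (h' - q ≫ e) := by
      rw [Preadditive.comp_sub, hh', ← Category.assoc, hkq, Limits.zero_comp, sub_zero]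
    exact congrArg (fun f => (f.app j).hom ⟨y, hy⟩) this

end IsFlatPartialLift

theorem exists_lift_of_forall_small {κ : Cardinal.{u}} (hκ : ℵ₀ ≤ κ) (hR : #R ≤ κ)
    (hJ : #J ≤ κ) (hE : #(Σ a b : J, (a ⟶ b)) ≤ κ) {F I Q : J ⥤ ModuleCat.{u} R} [Injective I]
    (p : I ⟶ Q)
    (hp : ∀ N : J ⥤ ModuleCat.{u} R, (∀ j, IsFlatModule R (N.obj j)) → #(Σ j, N.obj j) ≤ κ →
      ∀ g : N ⟶ Q, ∃ h : N ⟶ I, h ≫ p = g)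
    (hF : ∀ j, IsFlatModule R (F.obj j)) (g : F ⟶ Q) : ∃ h : F ⟶ I, h ≫ p = g := by
  obtain ⟨f, -, hmax⟩ := zorn_le_nonempty₀ {f | IsFlatPartialLift p g f}
    (fun c hc hchain y hy => IsFlatPartialLift.exists_upperBound hc hchain ⟨y, hy⟩) _
    (IsFlatPartialLift.bot fun j => isFlatModule_iff.1 (hF j))
  have hf : IsFlatPartialLift p g f := hmax.prop
  have htop : ∀ j x, x ∈ (f j).domain := fun j x => by
    obtain ⟨f', hf', hle, hx⟩ := hf.exists_extension hκ hR hJ hE hp j x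
    exact (hmax.le_of_ge hf' hle j).1 hx
  let s : F ⟶ hf.domain.toRep :=
    { app := fun j => ModuleCat.ofHom (LinearMap.id.codRestrict (f j).domain (htop j)) }
  refine ⟨s ≫ hf.hom, ?_⟩
  ext j x
  exact hf.lift j ⟨x, htop j x⟩

/-! ### Sets of representatives and counting paths -/

/-- The free representation with generators `A` at each object. -/
noncomputable def freeRep (J : Type u) [Category.{u} J] (R : Type u) [Ring R] (A : Type u) :
    J ⥤ ModuleCat.{u} R where
  obj j := ModuleCat.of R ((Σ i : J, (i ⟶ j) × A) →₀ R)
  map f := ModuleCat.ofHom (Finsupp.lmapDomain R R fun z => ⟨z.1, z.2.1 ≫ f, z.2.2⟩)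
  map_id j := ModuleCat.hom_ext (Finsupp.lhom_ext fun z r => by simp)
  map_comp f g := ModuleCat.hom_ext (Finsupp.lhom_ext fun z r => by
    simp [Finsupp.mapDomain_single])

/-- Bounds the isomorphism classes: the subrepresentations of one fixed free representation form a
small type. -/
theorem exists_quotient_freeRep_iso {A : Type u} (M : J ⥤ ModuleCat.{u} R)
    (hM : #(Σ j, M.obj j) ≤ #A) :
    ∃ K : Subrep (freeRep J R A), Nonempty (M ≅ K.quotient) := by
  obtain ⟨e⟩ := hM
  let s : ∀ j, A → M.obj j := fun j => Function.invFun fun m => e ⟨j, m⟩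
  have hs : ∀ j, Function.Surjective (s j) := fun j =>
    Function.invFun_surjective fun a b h => eq_of_heq (Sigma.mk.inj (e.injective h)).2
  let φ : freeRep J R A ⟶ M :=
    { app := fun j => ModuleCat.ofHom (Finsupp.linearCombination R fun z => M.map z.2.1 (s z.1 z.2.2))
      naturality := fun i j f => ModuleCat.hom_ext (Finsupp.lhom_ext fun z r => by
        simp [freeRep, Finsupp.mapDomain_single]) }
  have hφ : ∀ j, Function.Surjective (φ.app j) := fun j m => by
    obtain ⟨a, rfl⟩ := hs j m
    exact ⟨Finsupp.single ⟨j, 𝟙 j, a⟩ 1, (Finsupp.linearCombination_single R _ _).trans (by simp)⟩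
  let K : Subrep (freeRep J R A) :=
    { carrier := fun j => LinearMap.ker (φ.app j).hom
      map_mem := fun f x hx => by
        have := NatTrans.naturality_apply φ f x
        rw [LinearMap.mem_ker] at hx ⊢
        refine this.trans ?_
        rw [hx, map_zero] }
  refine ⟨K, ⟨(NatIso.ofComponents (fun j =>
    ((φ.app j).hom.quotKerEquivOfSurjective (hφ j)).toModuleIso) ?_).symm⟩⟩
  intro i j f
  ext x
  obtain ⟨y, rfl⟩ := (K.carrier i).mkQ_surjective x
  exact NatTrans.naturality_apply φ f y

end Representation

section Representatives
variable {C : Type u} [Category.{v} C]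

/-- An essentially small class closed under isomorphism has a set of representatives. -/
theorem exists_isSetOfRepresentatives (P : ObjectProperty C) {ι : Type v} (Y : ι → C)
    (hY : ∀ X, P X → ∃ i, Nonempty (X ≅ Y i)) : ∃ T, IsSetOfRepresentatives T P := by
  classical
  let q : {X : C // P X} → Quotient (isIsomorphicSetoid C) := fun X => ⟦X.1⟧
  let σ : Set.range q → {X : C // P X} := fun z => z.2.choose
  have hσ : ∀ z, q (σ z) = z.1 := fun z => z.2.choose_spec
  have hq : ∀ X X', q X = q X' ↔ Nonempty (X.1 ≅ X'.1) := fun X X' => Quotient.eq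
  have : Small.{v} (Set.range q) := by
    have hsub : Set.range q ⊆ Set.range fun i => (⟦Y i⟧ : Quotient (isIsomorphicSetoid C)) := by
      rintro _ ⟨X, rfl⟩
      obtain ⟨i, ⟨e⟩⟩ := hY X.1 X.2
      exact ⟨i, Quotient.sound ⟨e.symm⟩⟩
    exact small_subset hsub
  refine ⟨.ofObj fun z => (σ z).1, inferInstance, ?_, fun X hX => ?_⟩
  · rintro _ ⟨z⟩
    exact (σ z).2
  · refine ⟨(σ ⟨q ⟨X, hX⟩, ⟨_, rfl⟩⟩).1, ⟨⟨_⟩, (hq ⟨X, hX⟩ _).1 (hσ ⟨q ⟨X, hX⟩, ⟨_, rfl⟩⟩).symm⟩, ?_⟩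
    rintro _ ⟨⟨z⟩, h⟩
    have h' : q ⟨X, hX⟩ = z.1 := ((hq ⟨X, hX⟩ (σ z)).2 h).trans (hσ z)
    have : z = ⟨q ⟨X, hX⟩, ⟨_, rfl⟩⟩ := Subtype.ext h'.symm
    rw [this]

end Representatives

/-- The list of arrows of a path. -/
def Quiver.Path.arrows {V : Type u} [Quiver.{v} V] {a : V} :
    ∀ {b : V}, Quiver.Path a b → List (Σ a b : V, (a ⟶ b))
  | _, .nil => []
  | _, .cons p e => ⟨_, _, e⟩ :: p.arrows

/-- With the source fixed, even the empty list determines its path, so paths from `a` inject into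
lists of arrows. -/
theorem Quiver.Path.sigma_eq_of_arrows_eq {V : Type u} [Quiver.{v} V] {a b : V}
    (p : Quiver.Path a b) : ∀ {c : V} (q : Quiver.Path a c), p.arrows = q.arrows →
      (⟨b, p⟩ : Σ b, Quiver.Path a b) = ⟨c, q⟩ := by
  induction p with
  | nil =>
    rintro c (_ | ⟨q, e⟩) h
    · rfl
    · simp [arrows] at h
  | cons p e ih =>
    rintro c (_ | ⟨q, e'⟩) h
    · simp [arrows] at h
    · obtain ⟨h1, h2⟩ := List.cons.inj h
      obtain ⟨rfl, h1⟩ := Sigma.mk.inj h1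
      obtain ⟨rfl, h1⟩ := Sigma.mk.inj (eq_of_heq h1)
      obtain rfl := eq_of_heq h1
      obtain rfl := eq_of_heq (Sigma.mk.inj (ih q h2)).2
      rfl

theorem Quiver.mk_paths_le (V : Type u) [Quiver.{u} V] {κ : Cardinal.{u}} (hκ : ℵ₀ ≤ κ)
    (hV : #V ≤ κ) (hE : #(Σ a b : V, (a ⟶ b)) ≤ κ) :
    #(Σ a b : Paths V, (a ⟶ b)) ≤ κ := by
  refine mk_sigma_le_of_le hκ hV fun a => le_trans (mk_le_of_injective
    (f := fun p : Σ b : V, Quiver.Path (V := V) a b => p.2.arrows) fun p q h =>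
      p.2.sigma_eq_of_arrows_eq q.2 h) ((mk_list_le_max _).trans (max_le hκ hE))

/-! ### The main theorem -/

theorem mainTheorem3 (R : Type u) [Ring R] (V : Type u) [Quiver.{u} V] :
    IsCogeneratedBySet (componentwiseFlat R V) ∧
    ∀ κ : Cardinal.{u}, ℵ₀ ≤ κ → #R ≤ κ → #V ≤ κ → #(Σ a b : V, (a ⟶ b)) ≤ κ →
      (∃ T : ObjectProperty (QuiverRep R V),
        IsSetOfRepresentatives T (componentwiseFlatLE R V κ)) ∧
      ∀ T : ObjectProperty (QuiverRep R V),
        IsSetOfRepresentatives T (componentwiseFlatLE R V κ) →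
          extPerp T = extPerp (componentwiseFlat R V) := by
  have key : ∀ κ : Cardinal.{u}, ℵ₀ ≤ κ → #R ≤ κ → #V ≤ κ → #(Σ a b : V, (a ⟶ b)) ≤ κ →
      (∃ T : ObjectProperty (QuiverRep R V),
        IsSetOfRepresentatives T (componentwiseFlatLE R V κ)) ∧
      ∀ T : ObjectProperty (QuiverRep R V),
        IsSetOfRepresentatives T (componentwiseFlatLE R V κ) →
          extPerp T = extPerp (componentwiseFlat R V) := by
    intro κ hκ hR hV hE
    refine ⟨exists_isSetOfRepresentatives _
      (fun K : Subrep (freeRep (Paths V) R κ.out) => K.quotient) fun X hX =>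
      exists_quotient_freeRep_iso X (hX.2.trans (mk_out κ).ge), fun T hT => ?_⟩
    ext X
    let _ : HasExt.{u + 1} (QuiverRep R V) := HasExt.standard _
    let S : ShortComplex (QuiverRep R V) :=
      ShortComplex.mk _ _ (Limits.cokernel.condition (Injective.ι X))
    have hS : S.ShortExact :=
      { exact := ShortComplex.exact_of_g_is_cokernel _ (Limits.cokernelIsCokernel _) }
    have : Injective S.X₂ := inferInstanceAs (Injective (Injective.under X))
    constructor
    · intro h Y hY
      refine (subsingleton_ext_one_iff hS Y).2 fun g =>
        exists_lift_of_forall_small (J := Paths V) hκ hR hV (Quiver.mk_paths_le V hκ hV hE) S.g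
          (fun N hN hNκ g => ?_) hY g
      -- Lifting is invariant under isomorphism, so a small `N` may be replaced by its
      -- representative in `T`.
      obtain ⟨N', ⟨hN', ⟨e⟩⟩, -⟩ := hT.existsUnique N ⟨hN, hNκ⟩
      obtain ⟨h', hh'⟩ := (subsingleton_ext_one_iff hS N').1 (h N' hN') (e.inv ≫ g)
      exact ⟨e.hom ≫ h', by simp [hh']⟩
    · exact fun h Y hY => h Y (hT.le _ hY).1
  refine ⟨?_, key⟩
  let κ : Cardinal.{u} := max (max ℵ₀ #R) (max #V #(Σ a b : V, (a ⟶ b)))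
  obtain ⟨⟨T, hT⟩, h⟩ := key κ (by simp [κ]) (by simp [κ]) (by simp [κ]) (by simp [κ])
  exact ⟨T, hT.small, fun X hX => (hT.le X hX).1, h T hT⟩
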